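/- Let $G=(V,E,m,w)$ be a weighted graph: $(V,E)$ is a connected, locally finite, simple, undirected graph, $m:V\to(0,\infty)$ and $w:E\to(0,\infty)$, $w(x,y)=w(y,x)$. Let $d$ be the combinatorial graph distance, $B_R(x)=\{y: d(y,x)\le R\}$, $S_R(x)=\{y: d(y,x)=R\}$, and for $f:V\to\mathbb R$ let $$\Delta f(x)=\sum_{y\sim x}\frac{w(x,y)}{m(x)}\,(f(y)-f(x)),\qquad \nabla_{xy}f=\frac{f(x)-f(y)}{d(x,y)},\qquad |\nabla f|_\infty=\sup_{x\sim y}\nabla_{xy}f .$$ The (modified) Ollivier curvature of $x\ne y$ is $$\kappa(x,y)=\inf\{\nabla_{xy}\Delta f \;:\; f:V\to\mathbb R,\ \nabla_{yx}f=1,\ |\nabla f|_\infty=1\}.$$ Suppose that $G$ has bounded geometry, i.e. there is a constant $C>0$ such that $\deg(x)\le C$ and $C^{-1}\le m(x)\le C$ for all $x\in V$, and $C^{-1}\le w(x,y)\le C$ for all $x\sim y$. Let $x_0\in V$ and $R_0\in\mathbb N=\{0,1,2,\dots\}$ be such that $B_{R_0}(x_0)\neq V$ (which is automatic when $V$ is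 infinite), and suppose that $\kappa(x,y)\ge 0$ for every edge $\{x,y\}$ with both endpoints outside $B_{R_0}(x_0)$. Then the real vector space $\mathcal H_0(G)$ of bounded functions $u:V\to\mathbb R$ with $\Delta u=0$ on $V$ satisfies $$\dim \mathcal H_0(G)\le \sharp S_{R_0+1}(x_0)<\infty .$$ -/

import Mathlib

/-- A weighted graph `(V, E, m, w)`: a connected, locally finite, simple, undirected graph with
positive vertex weights `m` and positive symmetric edge weights `w`. The values of `w` on pairs
that are not edges are irrelevant: they occur in no definition below. -/
structure WeightedGraph (V : Type*) where
  graph : SimpleGraph V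
  connected : graph.Connected
  locallyFinite : ∀ x, (graph.neighborSet x).Finite
  m : V → ℝ
  m_pos : ∀ x, 0 < m x
  w : V → V → ℝ
  w_symm : ∀ x y, graph.Adj x y → w x y = w y x
  w_pos : ∀ x y, graph.Adj x y → 0 < w x y

namespace WeightedGraph

/-- The ball `B_R(x)` for the combinatorial distance. -/
def ball {V : Type*} (G : WeightedGraph V) (x : V) (R : ℕ) : Set V :=
  {y | G.graph.dist y x ≤ R}

/-- The sphere `S_R(x)` for the combinatorial distance. -/
def sphere {V : Type*} (G : WeightedGraph V) (x : V) (R : ℕ) : Set V :=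
  {y | G.graph.dist y x = R}

/-- The Laplacian `Δ f (x) = ∑_{y ∼ x} w(x,y) / m(x) * (f(y) - f(x))`. -/
noncomputable def laplacian {V : Type*} (G : WeightedGraph V) (f : V → ℝ) (x : V) : ℝ :=
  ∑ y ∈ (G.locallyFinite x).toFinset, G.w x y / G.m x * (f y - f x)

/-- Bounded geometry: degrees are bounded, and the weights are bounded above and away from `0`. -/
def BoundedGeometry {V : Type*} (G : WeightedGraph V) : Prop :=
  ∃ C : ℝ, 0 < C ∧
    (∀ x, ((G.graph.neighborSet x).ncard : ℝ) ≤ C) ∧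
    (∀ x, C⁻¹ ≤ G.m x ∧ G.m x ≤ C) ∧
    (∀ x y, G.graph.Adj x y → C⁻¹ ≤ G.w x y ∧ G.w x y ≤ C)

/-- The space `H_0(G)` of bounded harmonic functions on the whole vertex set. -/
def boundedHarmonic {V : Type*} (G : WeightedGraph V) : Submodule ℝ (V → ℝ) where
  carrier := {u | (∀ x, G.laplacian u x = 0) ∧ ∃ M : ℝ, ∀ x, |u x| ≤ M}
  zero_mem' := ⟨fun x => by simp [laplacian], 0, fun x => by simp⟩
  add_mem' := by
    rintro u v ⟨hu, M, hM⟩ ⟨hv, N, hN⟩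
    refine ⟨fun x => ?_, M + N, fun x => (abs_add_le _ _).trans (add_le_add (hM x) (hN x))⟩
    have h : G.laplacian (u + v) x = G.laplacian u x + G.laplacian v x := by
      simp only [laplacian, Pi.add_apply, ← Finset.sum_add_distrib]
      exact Finset.sum_congr rfl fun y _ => by ring
    rw [h, hu x, hv x, add_zero]
  smul_mem' := by
    rintro c u ⟨hu, M, hM⟩
    refine ⟨fun x => ?_, |c| * M, fun x => ?_⟩
    · have h : G.laplacian (c • u) x = c * G.laplacian u x := by
        simp only [laplacian, Pi.smul_apply, smul_eq_mul, Finset.mul_sum]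
        exact Finset.sum_congr rfl fun y _ => by ring
      rw [h, hu x, mul_zero]
    · simpa [abs_mul] using mul_le_mul_of_nonneg_left (hM x) (abs_nonneg c)

/-- The difference quotient `∇_{xy} f = (f(x) - f(y)) / d(x,y)`. -/
noncomputable def grad {V : Type*} (G : WeightedGraph V) (x y : V) (f : V → ℝ) : ℝ :=
  (f x - f y) / (G.graph.dist x y : ℝ)

/-- `|∇ f|_∞ = sup_{x ∼ y} ∇_{xy} f`, an extended real number. -/
noncomputable def gradSup {V : Type*} (G : WeightedGraph V) (f : V → ℝ) : EReal :=
  ⨆ (x : V) (y : V) (_ : G.graph.Adj x y), ((G.grad x y f : ℝ) : EReal)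

/-- The (modified) Ollivier curvature
`κ(x,y) = inf { ∇_{xy} Δ f : f : V → ℝ, ∇_{yx} f = 1, |∇ f|_∞ = 1 }` of distinct vertices `x`,
`y`. The infimum is taken in the extended reals (it is in fact finite), so that no default value
can occur. -/
noncomputable def ollivierCurvature {V : Type*} (G : WeightedGraph V) (x y : V) : EReal :=
  ⨅ (f : V → ℝ) (_ : G.grad y x f = 1) (_ : G.gradSup f = 1),
    ((G.grad x y (G.laplacian f) : ℝ) : EReal)

/-- Nonnegative Ollivier curvature outside `Ω`: `κ(x,y) ≥ 0` for every edge `{x,y}` with both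
endpoints outside `Ω`. -/
def NonnegOllivierOutside {V : Type*} (G : WeightedGraph V) (Ω : Set V) : Prop :=
  ∀ x y, G.graph.Adj x y → x ∉ Ω → y ∉ Ω → 0 ≤ G.ollivierCurvature x y

end WeightedGraph

namespace WeightedGraph

variable {V : Type*} (G : WeightedGraph V)

/-! Restriction to the sphere of radius `R₀ + 1` is injective on bounded harmonic functions. If `u`
vanishes there, the maximum principle kills it on the whole ball, so every edge where `u` is not
constant avoids `B_{R₀}` and has nonnegative curvature. A Liouville argument (`false_of_slope_one`)
then makes `u` constant.

For that, scale the maximal slope of `u` to 1. Nonnegative curvature says that the Laplacian does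
not increase up an edge of maximal slope; for `u` itself this is the empty `0 ≤ 0`. So test `u + ε
exp (a u)` instead: for large `a`, the Laplacian of `exp (a u)` strictly increases up every edge of
slope close to 1. As the supremum of slopes need not be attained, the curvature inequality is needed
with an error for nearly maximal edges. -/

lemma lipschitz_of_adj {f : V → ℝ} {L : ℝ}
    (hf : ∀ a b, G.graph.Adj a b → f b - f a ≤ L) (a b : V) :
    f b - f a ≤ L * G.graph.dist a b := by
  obtain ⟨p, hp⟩ := G.connected.exists_walk_length_eq_dist a b
  rw [← hp]
  clear hp
  induction p with
  | nil => simp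
  | cons h p ih =>
    have := hf _ _ h
    simp only [SimpleGraph.Walk.length_cons, Nat.cast_add, Nat.cast_one]
    linarith

lemma laplacian_smul (c : ℝ) (f : V → ℝ) (x : V) :
    G.laplacian (fun v => c * f v) x = c * G.laplacian f x := by
  simp only [laplacian, Finset.mul_sum]
  exact Finset.sum_congr rfl fun y _ => by ring

lemma laplacian_add (f g : V → ℝ) (x : V) :
    G.laplacian (fun v => f v + g v) x = G.laplacian f x + G.laplacian g x := by
  simp only [laplacian, ← Finset.sum_add_distrib]
  exact Finset.sum_congr rfl fun y _ => by ring

/-! ### Curvature tested on functions of nearly maximal slope -/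

lemma laplacian_le_add_of_slope_le_add {f g : V → ℝ} {x : V} {δ P : ℝ} (hδ : 0 ≤ δ)
    (hP : ∑ y ∈ (G.locallyFinite x).toFinset, G.w x y / G.m x ≤ P)
    (h : ∀ y, f y - f x ≤ g y - g x + δ) :
    G.laplacian f x ≤ G.laplacian g x + P * δ := by
  refine le_trans ?_ (add_le_add_right (mul_le_mul_of_nonneg_right hP hδ) _)
  rw [laplacian, laplacian, Finset.sum_mul, ← Finset.sum_add_distrib]
  refine Finset.sum_le_sum fun y hy => ?_
  rw [← mul_add]
  have hy' : G.graph.Adj x y := by simpa using hy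
  exact mul_le_mul_of_nonneg_left (h y) (div_pos (G.w_pos _ _ hy') (G.m_pos x)).le

/-- Nonnegative curvature of an edge, tested on an `L`-Lipschitz function which attains the
slope `L` on that edge. -/
lemma laplacian_le_of_ollivierCurvature_nonneg {x y : V} (hxy : G.graph.Adj x y)
    (hκ : 0 ≤ G.ollivierCurvature x y) {f : V → ℝ} {L : ℝ} (hL : 0 < L)
    (hf : ∀ a b, G.graph.Adj a b → f b - f a ≤ L) (hfxy : f y - f x = L) :
    G.laplacian f y ≤ G.laplacian f x := by
  have hd : G.graph.dist x y = 1 := SimpleGraph.dist_eq_one_iff_adj.2 hxy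
  have hd' : G.graph.dist y x = 1 := SimpleGraph.dist_eq_one_iff_adj.2 hxy.symm
  have h1 : G.grad y x (fun v => L⁻¹ * f v) = 1 := by
    simp only [grad, hd', Nat.cast_one, div_one]
    rw [← mul_sub, hfxy, inv_mul_cancel₀ hL.ne']
  have h2 : G.gradSup (fun v => L⁻¹ * f v) = 1 := by
    apply le_antisymm
    · refine iSup_le fun a => iSup_le fun b => iSup_le fun hab => ?_
      have : G.graph.dist a b = 1 := SimpleGraph.dist_eq_one_iff_adj.2 hab
      have h3 : L⁻¹ * f a - L⁻¹ * f b ≤ 1 := by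
        rw [← mul_sub, inv_mul_le_iff₀ hL, mul_one]
        exact hf b a hab.symm
      simp only [grad, this, Nat.cast_one, div_one]
      exact_mod_cast h3
    · refine le_trans (le_of_eq ?_)
        (le_iSup_of_le y (le_iSup_of_le x (le_iSup_of_le hxy.symm le_rfl)))
      rw [h1]
      rfl
  have h3 : (0 : EReal) ≤ ((G.grad x y (G.laplacian fun v => L⁻¹ * f v) : ℝ) : EReal) :=
    hκ.trans (iInf_le_of_le _ (iInf_le_of_le h1 (iInf_le _ h2)))
  have h4 : 0 ≤ G.grad x y (G.laplacian fun v => L⁻¹ * f v) := by exact_mod_cast h3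
  simp only [grad, hd, Nat.cast_one, div_one, laplacian_smul, ← mul_sub] at h4
  have := nonneg_of_mul_nonneg_right h4 (inv_pos.2 hL)
  linarith

/-- Nonnegative curvature of an edge, tested on an `L`-Lipschitz function whose slope on that
edge is at least `L - δ`. -/
lemma laplacian_le_add_of_ollivierCurvature_nonneg {P : ℝ}
    (hP : ∀ x, ∑ y ∈ (G.locallyFinite x).toFinset, G.w x y / G.m x ≤ P)
    {x y : V} (hxy : G.graph.Adj x y)
    (hκ : 0 ≤ G.ollivierCurvature x y) {f : V → ℝ} {L δ : ℝ} (hL : 0 < L)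
    (hf : ∀ a b, G.graph.Adj a b → f b - f a ≤ L) (hfxy : L - δ ≤ f y - f x) :
    G.laplacian f y ≤ G.laplacian f x + 2 * P * δ := by
  have hδ : 0 ≤ δ := by linarith [hf x y hxy]
  -- The cone of slope `L` with apex value `f x + L` at `y` restores the full slope on the edge. It
  -- equals `f x` at `x`, and by the Lipschitz bound it exceeds `f` by at most `δ` anywhere.
  set g : V → ℝ := fun v => max (f v) (f x + L - L * G.graph.dist y v) with hg
  have hgx : g x = f x := by
    simp [hg, SimpleGraph.dist_eq_one_iff_adj.2 hxy.symm]
  have hgy : g y = f x + L := by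
    simp only [hg, SimpleGraph.dist_self, Nat.cast_zero, mul_zero, sub_zero]
    exact max_eq_right (by linarith [hf x y hxy])
  have hfg : ∀ v, f v ≤ g v := fun v => le_max_left _ _
  have hgf : ∀ v, g v ≤ f v + δ := fun v => by
    have := G.lipschitz_of_adj hf v y
    rw [SimpleGraph.dist_comm] at this
    exact max_le (by linarith) (by linarith)
  have hgL : ∀ a b, G.graph.Adj a b → g b - g a ≤ L := fun a b hab => by
    rw [sub_le_iff_le_add]
    refine max_le (by linarith [hf a b hab, hfg a]) ?_
    have h1 : G.graph.dist y a ≤ G.graph.dist y b + 1 := by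
      have := G.connected.dist_triangle (u := y) (v := b) (w := a)
      rwa [SimpleGraph.dist_eq_one_iff_adj.2 hab.symm] at this
    have h2 : (G.graph.dist y a : ℝ) ≤ G.graph.dist y b + 1 := by exact_mod_cast h1
    have h3 : f x + L - L * G.graph.dist y a ≤ g a := le_max_right _ _
    nlinarith
  have key := G.laplacian_le_of_ollivierCurvature_nonneg hxy hκ hL hgL (by rw [hgx, hgy]; ring)
  have h1 : G.laplacian f y ≤ G.laplacian g y + P * δ :=
    G.laplacian_le_add_of_slope_le_add hδ (hP y) fun v => by linarith [hfg v, hgf y]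
  have h2 : G.laplacian g x ≤ G.laplacian f x + P * δ :=
    G.laplacian_le_add_of_slope_le_add hδ (hP x) fun v => by linarith [hgf v]
  linarith

/-! ### The Laplacian of `exp (a u)` for harmonic `u` -/

lemma laplacian_exp_eq {u : V → ℝ} (hu : ∀ x, G.laplacian u x = 0) (a : ℝ) (x : V) :
    G.laplacian (fun v => Real.exp (a * u v)) x = Real.exp (a * u x) *
      ∑ y ∈ (G.locallyFinite x).toFinset, G.w x y / G.m x *
        (Real.exp (a * (u y - u x)) - 1 - a * (u y - u x)) := by
  -- Subtracting a multiple of `Δu = 0` turns each summand into the convexity remainder `exp t - 1 -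
  -- t ≥ 0`.
  have h : G.laplacian (fun v => Real.exp (a * u v)) x =
      G.laplacian (fun v => Real.exp (a * u v)) x
        - Real.exp (a * u x) * a * G.laplacian u x := by
    rw [hu x]; ring
  rw [h, laplacian, laplacian, Finset.mul_sum, Finset.mul_sum, ← Finset.sum_sub_distrib]
  refine Finset.sum_congr rfl fun y _ => ?_
  have : Real.exp (a * u y) = Real.exp (a * u x) * Real.exp (a * (u y - u x)) := by
    rw [← Real.exp_add]; ring_nf
  rw [this]; ring

lemma laplacian_exp_le {u : V → ℝ} (hu : ∀ x, G.laplacian u x = 0)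
    (hlip : ∀ x y, G.graph.Adj x y → u y - u x ≤ 1) {a P : ℝ} (ha : 0 ≤ a)
    (hP : ∀ x, ∑ y ∈ (G.locallyFinite x).toFinset, G.w x y / G.m x ≤ P) (x : V) :
    G.laplacian (fun v => Real.exp (a * u v)) x ≤ Real.exp (a * u x) * (P * Real.exp a) := by
  rw [G.laplacian_exp_eq hu]
  refine mul_le_mul_of_nonneg_left ?_ (Real.exp_pos _).le
  refine le_trans ?_ (mul_le_mul_of_nonneg_right (hP x) (Real.exp_pos a).le)
  rw [Finset.sum_mul]
  refine Finset.sum_le_sum fun y hy => ?_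
  have hy' : G.graph.Adj x y := by simpa using hy
  refine mul_le_mul_of_nonneg_left ?_ (div_pos (G.w_pos _ _ hy') (G.m_pos x)).le
  have h1 := hlip x y hy'
  have h2 := hlip y x hy'.symm
  rcases le_total 0 (u y - u x) with h | h
  · have : Real.exp (a * (u y - u x)) ≤ Real.exp a := Real.exp_le_exp.2 (by nlinarith)
    have := mul_nonneg ha h
    linarith
  · have : Real.exp (a * (u y - u x)) ≤ 1 := Real.exp_le_one_iff.2 (by nlinarith)
    have := Real.add_one_le_exp a
    nlinarith

/-- All remainders are nonnegative, so the downhill neighbour `x` alone gives a bound, linear in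
`a`. -/
lemma le_laplacian_exp {u : V → ℝ} (hu : ∀ x, G.laplacian u x = 0) (a : ℝ) {q : ℝ}
    (hq : ∀ x y, G.graph.Adj x y → q ≤ G.w x y / G.m x) {x y : V} (hxy : G.graph.Adj y x)
    (hr : 0 ≤ a * (u y - u x) - 1) :
    Real.exp (a * u y) * (q * (a * (u y - u x) - 1)) ≤
      G.laplacian (fun v => Real.exp (a * u v)) y := by
  rw [G.laplacian_exp_eq hu]
  refine mul_le_mul_of_nonneg_left ?_ (Real.exp_pos _).le
  have hx : x ∈ (G.locallyFinite y).toFinset := by simpa using hxy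
  have hterm : ∀ z ∈ (G.locallyFinite y).toFinset, 0 ≤ G.w y z / G.m y *
      (Real.exp (a * (u z - u y)) - 1 - a * (u z - u y)) := fun z hz => by
    have hz' : G.graph.Adj y z := by simpa using hz
    refine mul_nonneg (div_pos (G.w_pos _ _ hz') (G.m_pos y)).le ?_
    linarith [Real.add_one_le_exp (a * (u z - u y))]
  refine le_trans ?_ (Finset.single_le_sum hterm hx)
  refine (mul_le_mul_of_nonneg_right (hq _ _ hxy) hr).trans
    (mul_le_mul_of_nonneg_left ?_ (div_pos (G.w_pos _ _ hxy) (G.m_pos y)).le)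
  linarith [Real.exp_pos (a * (u x - u y))]

/-! ### The Liouville property -/

/-- A bounded harmonic function all of whose edges of nonzero slope have nonnegative curvature
cannot have maximal slope one. -/
lemma false_of_slope_one {P q : ℝ} (hq0 : 0 < q)
    (hP : ∀ x, ∑ y ∈ (G.locallyFinite x).toFinset, G.w x y / G.m x ≤ P)
    (hq : ∀ x y, G.graph.Adj x y → q ≤ G.w x y / G.m x)
    {u : V → ℝ} (hu : ∀ x, G.laplacian u x = 0) {M : ℝ} (hM : ∀ x, |u x| ≤ M)
    (hκ : ∀ x y, G.graph.Adj x y → u x < u y → 0 ≤ G.ollivierCurvature x y)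
    (hlip : ∀ x y, G.graph.Adj x y → u y - u x ≤ 1)
    (hsup : ∀ η > 0, ∃ x y, G.graph.Adj x y ∧ 1 - η < u y - u x) : False := by
  obtain ⟨x₁, y₁, hxy₁, -⟩ := hsup 1 one_pos
  have hP0 : 0 ≤ P := (Finset.sum_nonneg fun y hy => (div_pos
    (G.w_pos x₁ y (by simpa using hy)) (G.m_pos x₁)).le).trans (hP x₁)
  set E := Real.exp 1 with hE
  have hE0 : 0 < E := Real.exp_pos 1
  -- With this `a`, the gain `q (a / 2 - 1)` at the upper endpoint beats the bound `P E` at the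
  -- lower one by 1. Also `a ≥ 2`, so `a - 2 ≥ a / 2 - 1`.
  set a : ℝ := 2 * ((P * E + 1) / q + 1) with ha
  have ha0 : 2 ≤ a := by
    have : 0 ≤ (P * E + 1) / q := by positivity
    linarith
  have haq : q * (a / 2 - 1) = P * E + 1 := by
    rw [ha]; field_simp; ring
  set A := Real.exp (a * M) with hA
  have hA0 : 0 < A := Real.exp_pos _
  have huA : ∀ x, Real.exp (a * u x) ≤ A := fun x =>
    Real.exp_le_exp.2 (mul_le_mul_of_nonneg_left (abs_le.1 (hM x)).2 (by linarith))
  have huA' : ∀ x, A⁻¹ ≤ Real.exp (a * u x) := fun x => by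
    rw [hA, ← Real.exp_neg]
    exact Real.exp_le_exp.2 (by nlinarith [(abs_le.1 (hM x)).1])
  -- the slope of `u` on a nearly optimal edge is at least `1 - a⁻¹ ≥ 1 / 2`
  set ε : ℝ := a⁻¹ / 2 / A with hε
  have ha1 : 0 < a⁻¹ := inv_pos.2 (by linarith)
  have hε0 : 0 < ε := by positivity
  have hεA : ε * A = a⁻¹ / 2 := by rw [hε]; field_simp
  -- The first entry keeps the slope of `u` above `1 - a⁻¹`; the second makes the curvature error `2
  -- P δ` smaller than the gap `ε A⁻¹`.
  set δ : ℝ := min (a⁻¹ / 4) (ε * A⁻¹ / (4 * (P + 1))) with hδ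
  have hδ0 : 0 < δ := by rw [hδ]; positivity
  set f : V → ℝ := fun v => u v + ε * Real.exp (a * u v) with hf
  let S : Set ℝ := {r | ∃ x y, G.graph.Adj x y ∧ r = f y - f x}
  have hfle : ∀ x y, f y - f x ≤ u y - u x + ε * A := fun x y => by
    have h1 := mul_le_mul_of_nonneg_left (huA y) hε0.le
    have h2 := mul_pos hε0 (Real.exp_pos (a * u x))
    simp only [hf]; linarith
  have hSb : BddAbove S := by
    refine ⟨1 + ε * A, ?_⟩
    rintro r ⟨x, y, hxy, rfl⟩
    linarith [hfle x y, hlip x y hxy]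
  set L := sSup S with hL
  have hfL : ∀ x y, G.graph.Adj x y → f y - f x ≤ L := fun x y hxy =>
    le_csSup hSb ⟨x, y, hxy, rfl⟩
  -- Where `u` increases, so does `exp (a u)`: the perturbation cannot lower the slope.
  have hL1 : 1 ≤ L := by
    refine le_of_forall_pos_sub_le fun η hη => ?_
    obtain ⟨x, y, hxy, h⟩ := hsup (min η 1) (lt_min hη one_pos)
    have h1 : u x ≤ u y := by linarith [min_le_right η 1]
    have h2 : Real.exp (a * u x) ≤ Real.exp (a * u y) :=
      Real.exp_le_exp.2 (mul_le_mul_of_nonneg_left h1 (by linarith))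
    have h3 := mul_le_mul_of_nonneg_left h2 hε0.le
    have h4 := hfL x y hxy
    simp only [hf] at h4
    linarith [min_le_left η 1]
  obtain ⟨_, ⟨x, y, hxy, rfl⟩, hlt⟩ :=
    exists_lt_of_lt_csSup (s := S) ⟨_, x₁, y₁, hxy₁, rfl⟩ (sub_lt_self L hδ0)
  set r := u y - u x with hr
  have hr1 : 1 - a⁻¹ ≤ r := by
    have := hfle x y
    have : δ ≤ a⁻¹ / 4 := min_le_left _ _
    linarith
  have har : a - 1 ≤ a * r := by
    have := mul_le_mul_of_nonneg_left hr1 (by linarith : 0 ≤ a)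
    rwa [mul_sub, mul_one, mul_inv_cancel₀ (by linarith : a ≠ 0)] at this
  have hrpos : 0 < r := by
    by_contra h
    nlinarith
  have key := G.laplacian_le_add_of_ollivierCurvature_nonneg hP hxy
    (hκ x y hxy (by linarith)) (by linarith) hfL hlt.le
  have hlap : ∀ z, G.laplacian f z = ε * G.laplacian (fun v => Real.exp (a * u v)) z := fun z => by
    rw [hf, G.laplacian_add, hu, zero_add, G.laplacian_smul]
  rw [hlap, hlap] at key
  have hup := G.laplacian_exp_le hu hlip (a := a) (by linarith) hP x
  have hlow := G.le_laplacian_exp hu a hq hxy.symm (by linarith)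
  have hlow2 : P * E + 1 ≤ q * (a * (u y - u x) - 1) := by
    rw [← haq]
    exact mul_le_mul_of_nonneg_left (by linarith) hq0.le
  -- The drop of `u` by nearly 1 absorbs the factor `exp a` of the upper bound, up to `E`.
  have hexp : Real.exp (a * u x) * Real.exp a ≤ Real.exp (a * u y) * E := by
    rw [hE, ← Real.exp_add, ← Real.exp_add]
    refine Real.exp_le_exp.2 ?_
    rw [hr] at har
    linarith
  have hgap : G.laplacian (fun v => Real.exp (a * u v)) x + A⁻¹ ≤
      G.laplacian (fun v => Real.exp (a * u v)) y := by
    have h1 := mul_le_mul_of_nonneg_left hlow2 (Real.exp_pos (a * u y)).le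
    have h2 := mul_le_mul_of_nonneg_left hexp hP0
    linarith [huA' y]
  have hδ2 : δ * (4 * (P + 1)) ≤ ε * A⁻¹ :=
    (le_div_iff₀ (by positivity)).1 (min_le_right _ _)
  have := mul_le_mul_of_nonneg_left hgap hε0.le
  nlinarith

/-- A Liouville property: a bounded harmonic function is constant if all edges on which it is
not constant have nonnegative curvature. -/
lemma eq_of_harmonic_of_ollivierCurvature_nonneg (hG : G.BoundedGeometry)
    {u : V → ℝ} (hu : ∀ x, G.laplacian u x = 0) {M : ℝ} (hM : ∀ x, |u x| ≤ M)
    (hκ : ∀ x y, G.graph.Adj x y → u x < u y → 0 ≤ G.ollivierCurvature x y) (x y : V) :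
    u x = u y := by
  obtain ⟨C, hC, hdeg, hm, hw⟩ := hG
  have hq : ∀ x y, G.graph.Adj x y → C⁻¹ / C ≤ G.w x y / G.m x := fun x y h =>
    div_le_div₀ (G.w_pos x y h).le (hw x y h).1 (G.m_pos x) (hm x).2
  have hP : ∀ x, ∑ y ∈ (G.locallyFinite x).toFinset, G.w x y / G.m x ≤ C * (C / C⁻¹) :=
    fun x => by
    refine (Finset.sum_le_card_nsmul _ _ (C / C⁻¹) fun y hy => ?_).trans ?_
    · have h : G.graph.Adj x y := by simpa using hy
      exact div_le_div₀ hC.le (hw x y h).2 (inv_pos.2 hC) (hm x).1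
    · rw [nsmul_eq_mul, ← Set.ncard_eq_toFinset_card _ (G.locallyFinite x)]
      exact mul_le_mul_of_nonneg_right (hdeg x) (by positivity)
  let S : Set ℝ := {r | ∃ x y, G.graph.Adj x y ∧ r = u y - u x}
  have hSb : BddAbove S := by
    refine ⟨2 * M, ?_⟩
    rintro r ⟨a, b, -, rfl⟩
    linarith [abs_le.1 (hM a), abs_le.1 (hM b)]
  set s := sSup S with hs
  have hus : ∀ a b, G.graph.Adj a b → u b - u a ≤ s := fun a b h => le_csSup hSb ⟨a, b, h, rfl⟩
  -- A graph without edges falls in the first case, since `sSup ∅ = 0`.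
  rcases le_or_gt s 0 with h0 | h0
  · have hle : ∀ a b, G.graph.Adj a b → u b - u a ≤ 0 := fun a b h => (hus a b h).trans h0
    have h1 := G.lipschitz_of_adj hle x y
    have h2 := G.lipschitz_of_adj hle y x
    linarith
  have hSne : S.Nonempty := by
    by_contra h
    rw [Set.not_nonempty_iff_eq_empty] at h
    rw [hs, h, Real.sSup_empty] at h0
    exact lt_irrefl _ h0
  have hs' : 0 < s⁻¹ := inv_pos.2 h0
  refine (G.false_of_slope_one (u := fun v => s⁻¹ * u v) (M := s⁻¹ * M)
    (by positivity : 0 < C⁻¹ / C) hP hq (fun z => ?_) (fun z => ?_) (fun a b hab h => ?_)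
    (fun a b hab => ?_) (fun η hη => ?_)).elim
  · rw [G.laplacian_smul, hu, mul_zero]
  · rw [abs_mul, abs_of_pos hs']
    exact mul_le_mul_of_nonneg_left (hM z) hs'.le
  · exact hκ a b hab (lt_of_mul_lt_mul_left h hs'.le)
  · rw [← mul_sub, inv_mul_le_iff₀ h0, mul_one]
    exact hus a b hab
  · obtain ⟨_, ⟨a, b, hab, rfl⟩, hlt⟩ :=
      exists_lt_of_lt_csSup hSne (sub_lt_self s (mul_pos h0 hη))
    refine ⟨a, b, hab, ?_⟩
    rw [← mul_sub, lt_inv_mul_iff₀ h0]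
    linarith

/-! ### Balls, spheres and the maximum principle -/

lemma dist_le_add_one {a b : V} (h : G.graph.Adj a b) (x : V) :
    G.graph.dist b x ≤ G.graph.dist a x + 1 := by
  have := G.connected.dist_triangle (u := b) (v := a) (w := x)
  rw [SimpleGraph.dist_eq_one_iff_adj.2 h.symm] at this
  omega

lemma finite_ball (x : V) (R : ℕ) : (G.ball x R).Finite := by
  induction R with
  | zero =>
    refine (Set.finite_singleton x).subset fun y hy => ?_
    have h : G.graph.dist y x = 0 := Nat.le_zero.1 hy
    exact (G.connected y x).dist_eq_zero_iff.1 h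
  | succ R ih =>
    refine (ih.union (ih.biUnion fun y _ => G.locallyFinite y)).subset fun y hy => ?_
    rcases Nat.lt_or_ge R (G.graph.dist y x) with h | h
    · right
      have hd : G.graph.dist y x = R + 1 := le_antisymm hy h
      obtain ⟨p, hp⟩ := G.connected.exists_walk_length_eq_dist y x
      cases p with
      | nil => simp at hd
      | @cons _ z _ hyz p =>
        simp only [Set.mem_iUnion]
        refine ⟨z, ?_, hyz.symm⟩
        have := SimpleGraph.dist_le p
        simp only [SimpleGraph.Walk.length_cons] at hp
        change G.graph.dist z x ≤ R
        omega
    · exact Or.inl h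

lemma finite_sphere (x : V) (R : ℕ) : (G.sphere x R).Finite :=
  (G.finite_ball x R).subset fun _ h => le_of_eq h

/-- The maximum principle on a ball that is not the whole graph. -/
lemma nonpos_on_ball {u : V → ℝ} (hu : ∀ x, G.laplacian u x = 0) {x₀ : V} {R : ℕ}
    (hproper : G.ball x₀ R ≠ Set.univ) (h0 : ∀ x ∈ G.sphere x₀ (R + 1), u x = 0) :
    ∀ x ∈ G.ball x₀ (R + 1), u x ≤ 0 := by
  intro x hx
  obtain ⟨z, hz, hmax⟩ := Set.exists_max_image _ u (G.finite_ball x₀ (R + 1)) ⟨x, hx⟩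
  refine (hmax x hx).trans ?_
  by_contra! hpos
  -- A positive maximum is never on the sphere, so all its neighbours lie in the larger ball.
  -- Harmonicity passes it on to them, and by connectedness it fills `V` without leaving `B_R`,
  -- against `hproper`.
  have hin : ∀ v ∈ G.ball x₀ (R + 1), u v = u z → v ∈ G.ball x₀ R := fun v hv h => by
    by_contra hv'
    have hs : G.graph.dist v x₀ = R + 1 := le_antisymm hv (Nat.lt_of_not_le hv')
    rw [← h, h0 v hs] at hpos
    exact lt_irrefl _ hpos
  have hstep : ∀ a b, G.graph.Adj a b → a ∈ G.ball x₀ R ∧ u a = u z →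
      b ∈ G.ball x₀ R ∧ u b = u z := by
    rintro a b hab ⟨ha, hua⟩
    have hball : ∀ c, G.graph.Adj a c → c ∈ G.ball x₀ (R + 1) := fun c hac =>
      (G.dist_le_add_one hac x₀).trans (Nat.succ_le_succ ha)
    have hsum := hu a
    rw [laplacian, Finset.sum_eq_zero_iff_of_nonpos] at hsum
    · have hb := hsum b (by simpa using hab)
      have hp : G.w a b / G.m a ≠ 0 := (div_pos (G.w_pos _ _ hab) (G.m_pos a)).ne'
      have : u b = u z := by
        have := (mul_eq_zero.1 hb).resolve_left hp
        linarith
      exact ⟨hin b (hball b hab) this, this⟩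
    · intro c hc
      have hac : G.graph.Adj a c := by simpa using hc
      refine mul_nonpos_of_nonneg_of_nonpos (div_pos (G.w_pos _ _ hac) (G.m_pos a)).le ?_
      linarith [hmax c (hball c hac)]
  refine hproper (Set.eq_univ_of_forall fun v => ?_)
  obtain ⟨p⟩ := G.connected z v
  have hwalk : ∀ {s t : V}, G.graph.Walk s t → s ∈ G.ball x₀ R ∧ u s = u z →
      t ∈ G.ball x₀ R ∧ u t = u z := by
    intro s t p
    induction p with
    | nil => exact id
    | cons h p ih => exact fun hs => ih (hstep _ _ h hs)
  exact (hwalk p ⟨hin z hz rfl, rfl⟩).1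

/-- A bounded harmonic function on a graph with nonnegative curvature outside a ball is determined
by its values on the sphere around that ball. -/
lemma eq_zero_of_eq_zero_on_sphere (hG : G.BoundedGeometry) {x₀ : V} {R : ℕ}
    (hproper : G.ball x₀ R ≠ Set.univ) (hκ : G.NonnegOllivierOutside (G.ball x₀ R))
    {u : V → ℝ} (hu : u ∈ G.boundedHarmonic) (h0 : ∀ x ∈ G.sphere x₀ (R + 1), u x = 0) :
    u = 0 := by
  have hball : ∀ x ∈ G.ball x₀ (R + 1), u x = 0 := fun x hx => by
    refine le_antisymm (G.nonpos_on_ball hu.1 hproper h0 x hx) ?_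
    have hneg := G.boundedHarmonic.neg_mem hu
    have := G.nonpos_on_ball hneg.1 hproper (fun y hy => by simp [h0 y hy]) x hx
    simpa using this
  obtain ⟨M, hM⟩ := hu.2
  have hconst := G.eq_of_harmonic_of_ollivierCurvature_nonneg hG hu.1 hM fun x y hxy hlt => by
    -- An edge meeting `B_R` lies in `B_{R+1}`, where `u` vanishes; hence the radius `R + 1`.
    have hout : ∀ a b, G.graph.Adj a b → u a ≠ u b → a ∉ G.ball x₀ R := fun a b hab hne ha => by
      refine hne ?_
      rw [hball a (Nat.le_succ_of_le ha),
        hball b ((G.dist_le_add_one hab x₀).trans (Nat.succ_le_succ ha))]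
    exact hκ x y hxy (hout x y hxy hlt.ne) (hout y x hxy.symm hlt.ne')
  funext x
  rw [hconst x x₀, hball x₀ (by simp [ball])]
  rfl

end WeightedGraph

theorem theorem1p3 {V : Type*} (G : WeightedGraph V) (hG : G.BoundedGeometry)
    (x₀ : V) (R₀ : ℕ) (hproper : G.ball x₀ R₀ ≠ Set.univ)
    (hκ : G.NonnegOllivierOutside (G.ball x₀ R₀)) :
    Module.rank ℝ G.boundedHarmonic ≤ Cardinal.mk (G.sphere x₀ (R₀ + 1)) ∧
      Cardinal.mk (G.sphere x₀ (R₀ + 1)) < Cardinal.aleph0 := by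
  have hfin := G.finite_sphere x₀ (R₀ + 1)
  refine ⟨?_, hfin.lt_aleph0⟩
  have := hfin.fintype
  let restrict : G.boundedHarmonic →ₗ[ℝ] (G.sphere x₀ (R₀ + 1) → ℝ) :=
    (LinearMap.funLeft ℝ ℝ Subtype.val).comp G.boundedHarmonic.subtype
  have hinj : Function.Injective restrict := by
    rw [← LinearMap.ker_eq_bot, LinearMap.ker_eq_bot']
    intro u hu
    exact Subtype.ext (G.eq_zero_of_eq_zero_on_sphere hG hproper hκ u.2 fun x hx =>
      congrFun hu ⟨x, hx⟩)
  refine (LinearMap.rank_le_of_injective restrict hinj).trans ?_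
  rw [rank_fun', Cardinal.mk_fintype]
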